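/- Let $N,n$ be natural numbers and $\lambda=(\lambda_1,\dots,\lambda_N)\in\mathbb Z_{\ge0}^N$ with $\lambda_1+\dots+\lambda_N=n$. Let $\mathcal I_\lambda$ be the set of all ordered partitions $I=(I_1,\dots,I_N)$ of $\{1,\dots,n\}$ into disjoint (possibly empty) subsets with $|I_k|=\lambda_k$. Put $\lambda^{(j)}=\lambda_1+\dots+\lambda_j$ and write $I_1\cup\dots\cup I_j=\{i^{(j)}_1<\dots<i^{(j)}_{\lambda^{(j)}}\}$. Consider variables $h$, $\boldsymbol z=(z_1,\dots,z_n)$ and $\boldsymbol t=(t^{(j)}_a)$, $1\le j\le N-1$, $1\le a\le\lambda^{(j)}$, and set $t^{(N)}_a=z_a$. For $I\in\mathcal I_\lambda$ let $$U_I(\boldsymbol t;\boldsymbol z;h)=\prod_{j=1}^{N-1}\prod_{a=1}^{\lambda^{(j)}}\Bigl(\prod_{c:\ i^{(j+1)}_c<i^{(j)}_a}(t^{(j)}_a-t^{(j+1)}_c-h)\prod_{d:\ i^{(j+1)}_d>i^{(j)}_a}(t^{(j)}_a-t^{(j+1)}_d)\prod_{b=a+1}^{\lambda^{(j)}}\frac{t^{(j)}_a-t^{(j)}_b-h}{t^{(j)}_a-t^{(j)}_b}\Bigr),$$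 $$W_I(\boldsymbol t;\boldsymbol z;h)=(-h)^{\lambda^{(1)}+\dots+\lambda^{(N-1)}}\ \mathrm{Sym}_{t^{(1)}}\cdots\mathrm{Sym}_{t^{(N-1)}}\,U_I(\boldsymbol t;\boldsymbol z;h),$$ where $\mathrm{Sym}_{t^{(j)}}$ is the sum over all permutations of the variables $t^{(j)}_1,\dots,t^{(j)}_{\lambda^{(j)}}$ (without normalization). For $\sigma\in S_n$ let $$W_{\sigma,I}(\boldsymbol t;\boldsymbol z;h)=W_{\sigma^{-1}(I)}(\boldsymbol t;z_{\sigma(1)},\dots,z_{\sigma(n)};h),\qquad \sigma^{-1}(I)=(\sigma^{-1}(I_1),\dots,\sigma^{-1}(I_N)).$$ For $I\in\mathcal I_\lambda$ and $f(\boldsymbol t;\boldsymbol z;h)$ symmetric in each group $t^{(1)},\dots,t^{(N-1)}$, let $f(\boldsymbol z_I;\boldsymbol z;h)$ be obtained by replacing, for each $j\le N-1$, the variables $t^{(j)}$ with $\{z_i: i\in I_1\cup\dots\cup I_j\}$. Put $$R(\boldsymbol z_I)=\prod_{a<b}\prod_{i\in I_a}\prod_{j\in I_b}(z_i-z_j),\qquad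 Q(\boldsymbol z_I)=\prod_{a<b}\prod_{i\in I_a}\prod_{j\in I_b}(z_i-z_j-h),$$ $$c_\lambda(\boldsymbol z_I)=\prod_{a=1}^{N-1}\ \prod_{i,j\in I_1\cup\dots\cup I_a}(z_i-z_j-h)$$ (the factors with $i=j$ are included). Let $\mathrm{id}\in S_n$ be the identity and $\sigma_0\in S_n$ the longest permutation, $\sigma_0(i)=n+1-i$. Then for all $J,K\in\mathcal I_\lambda$, in the field $\mathbb C(\boldsymbol z;h)$, $$\sum_{I\in\mathcal I_\lambda}\frac{W_{\mathrm{id},J}(\boldsymbol z_I;\boldsymbol z;h)\,W_{\sigma_0,K}(\boldsymbol z_I;\boldsymbol z;h)}{R(\boldsymbol z_I)\,Q(\boldsymbol z_I)\,c_\lambda(\boldsymbol z_I)^2}=\delta_{J,K}.$$ -/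

import Mathlib

noncomputable section

namespace WeightFn

open Finset

/-- The set `𝓘_λ` of ordered partitions `I = (I_1, …, I_N)` of an `n`-element set into (possibly
empty) blocks with `|I_k| = λ_k`. A partition is encoded by the map that sends a point to the index
of its block: `I_k = {a | I a = k}`. All indices in `Fin N`, `Fin n` are shifted by one. -/
abbrev Partitions {N : ℕ} (n : ℕ) (lam : Fin N → ℕ) : Type :=
  {I : Fin n → Fin N // ∀ k, #{a | I a = k} = lam k}

/-- `λ^{(j)} = λ_1 + ⋯ + λ_j`. -/
def partialSum {N : ℕ} (lam : Fin N → ℕ) (j : ℕ) : ℕ := ∑ k with k.val < j, lam k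

variable {N n : ℕ} {lam : Fin N → ℕ}

/-- The block `I_k`. -/
def block (I : Partitions n lam) (k : Fin N) : Finset (Fin n) := {a | I.1 a = k}

/-- The union `I_1 ∪ ⋯ ∪ I_j`. -/
def blockUnion (I : Partitions n lam) (j : ℕ) : Finset (Fin n) := {a | (I.1 a).val < j}

theorem card_blockUnion (I : Partitions n lam) (j : ℕ) :
    #(blockUnion I j) = partialSum lam j := by
  unfold partialSum blockUnion
  rw [Finset.card_eq_sum_card_fiberwise (f := I.1) (t := ({k | k.val < j} : Finset (Fin N)))
    (by intro a; simp)]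
  refine Finset.sum_congr rfl fun k hk => ?_
  rw [← I.2 k, Finset.filter_filter]
  congr 1
  ext a
  simp only [Finset.mem_filter, Finset.mem_univ, true_and] at hk ⊢
  constructor
  · exact fun h => h.2
  · exact fun h => ⟨h ▸ hk, h⟩

theorem partialSum_le (I : Partitions n lam) (j : ℕ) : partialSum lam j ≤ n := by
  rw [← card_blockUnion I j]
  simpa using Finset.card_le_univ (blockUnion I j)

/-- The increasing enumeration `i^{(j)}_1 < ⋯ < i^{(j)}_{λ^{(j)}}` of `I_1 ∪ ⋯ ∪ I_j`. -/
def enum (I : Partitions n lam) (j : ℕ) : Fin (partialSum lam j) ↪o Fin n :=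
  (blockUnion I j).orderEmbOfFin (card_blockUnion I j)

/-- `σ⁻¹(I) = (σ⁻¹(I_1), …, σ⁻¹(I_N))`. -/
def permInv (σ : Equiv.Perm (Fin n)) (I : Partitions n lam) : Partitions n lam :=
  ⟨I.1 ∘ σ, fun k => by
    rw [← I.2 k]
    exact Finset.card_bij (fun a _ => σ a) (by simp) (by simp)
      (fun b hb => ⟨σ.symm b, by simpa using hb, by simp⟩)⟩

/-- All levels of variables `t^{(j)}_a`: those with `1 ≤ j ≤ N - 1` are given by `t`, and
`t^{(N)}_a = z_a`. (Only the levels `1 ≤ j ≤ N` are ever used.) -/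
def levels {F : Type*} (I : Partitions n lam)
    (t : ∀ j : {j // j ∈ Ico 1 N}, Fin (partialSum lam j) → F) (z : Fin n → F)
    (j : ℕ) (a : Fin (partialSum lam j)) : F :=
  if hj : j ∈ Ico 1 N then t ⟨j, hj⟩ a else z (Fin.castLE (partialSum_le I j) a)

/-- The expression `U_I(t; z; h)`, for elements `t^{(j)}_a`, `h` of a field. -/
def U {F : Type*} [Field F] (I : Partitions n lam)
    (t : ∀ j : ℕ, Fin (partialSum lam j) → F) (h : F) : F :=
  ∏ j ∈ Ico 1 N, ∏ a : Fin (partialSum lam j),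
    ((∏ c with enum I (j + 1) c < enum I j a, (t j a - t (j + 1) c - h)) *
      (∏ d with enum I j a < enum I (j + 1) d, (t j a - t (j + 1) d)) *
      ∏ b with a < b, (t j a - t j b - h) / (t j a - t j b))

/-- The expression `W_I(t; z; h) = (-h)^{λ^{(1)} + ⋯ + λ^{(N-1)}} Sym_{t^{(1)}} ⋯ Sym_{t^{(N-1)}} U_I`,
for elements `t^{(j)}_a`, `z_a`, `h` of a field. -/
def W {F : Type*} [Field F] (I : Partitions n lam)
    (t : ∀ j : {j // j ∈ Ico 1 N}, Fin (partialSum lam j) → F) (z : Fin n → F) (h : F) : F :=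
  (-h) ^ (∑ j ∈ Ico 1 N, partialSum lam j) *
    ∑ τ : (∀ j : {j // j ∈ Ico 1 N}, Equiv.Perm (Fin (partialSum lam j))),
      U I (levels I (fun j a => t j (τ j a)) z) h

/-- Names of the variables `z_1, …, z_n, h`. -/
inductive ZHVar (n : ℕ) : Type
  | z (a : Fin n) : ZHVar n
  | h : ZHVar n

/-- Names of the variables `t^{(j)}_a` (`1 ≤ j ≤ N - 1`, `1 ≤ a ≤ λ^{(j)}`), `z_1, …, z_n`, `h`. -/
inductive TZHVar {N : ℕ} (n : ℕ) (lam : Fin N → ℕ) : Type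
  | t (j : {j // j ∈ Ico 1 N}) (a : Fin (partialSum lam j)) : TZHVar n lam
  | z (a : Fin n) : TZHVar n lam
  | h : TZHVar n lam

/-- The field `ℂ(z_1, …, z_n; h)`. -/
def RatZH (n : ℕ) : Type := FractionRing (MvPolynomial (ZHVar n) ℂ)

instance (n : ℕ) : Field (RatZH n) :=
  inferInstanceAs (Field (FractionRing (MvPolynomial (ZHVar n) ℂ)))

instance (n : ℕ) : Algebra ℂ (RatZH n) :=
  inferInstanceAs (Algebra ℂ (FractionRing (MvPolynomial (ZHVar n) ℂ)))

instance (n : ℕ) : Algebra (MvPolynomial (ZHVar n) ℂ) (RatZH n) :=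
  inferInstanceAs (Algebra (MvPolynomial (ZHVar n) ℂ) (FractionRing (MvPolynomial (ZHVar n) ℂ)))

instance (n : ℕ) : IsScalarTower ℂ (MvPolynomial (ZHVar n) ℂ) (RatZH n) :=
  inferInstanceAs
    (IsScalarTower ℂ (MvPolynomial (ZHVar n) ℂ) (FractionRing (MvPolynomial (ZHVar n) ℂ)))

instance (n : ℕ) : IsFractionRing (MvPolynomial (ZHVar n) ℂ) (RatZH n) :=
  inferInstanceAs
    (IsFractionRing (MvPolynomial (ZHVar n) ℂ) (FractionRing (MvPolynomial (ZHVar n) ℂ)))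

/-- The variable `z_a` as an element of `ℂ(z; h)`. -/
def zvar (a : Fin n) : RatZH n := algebraMap (MvPolynomial _ ℂ) _ (MvPolynomial.X (R := ℂ) (ZHVar.z a))

/-- The variable `h` as an element of `ℂ(z; h)`. -/
def hvar : RatZH n := algebraMap (MvPolynomial _ ℂ) _ (MvPolynomial.X (R := ℂ) (ZHVar.h (n := n)))

/-- The field `ℂ(t; z; h)`. -/
def RatTZH {N : ℕ} (n : ℕ) (lam : Fin N → ℕ) : Type :=
  FractionRing (MvPolynomial (TZHVar n lam) ℂ)

instance : Field (RatTZH n lam) :=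
  inferInstanceAs (Field (FractionRing (MvPolynomial (TZHVar n lam) ℂ)))

instance : Algebra (MvPolynomial (TZHVar n lam) ℂ) (RatTZH n lam) :=
  inferInstanceAs
    (Algebra (MvPolynomial (TZHVar n lam) ℂ) (FractionRing (MvPolynomial (TZHVar n lam) ℂ)))

instance : IsFractionRing (MvPolynomial (TZHVar n lam) ℂ) (RatTZH n lam) :=
  inferInstanceAs
    (IsFractionRing (MvPolynomial (TZHVar n lam) ℂ) (FractionRing (MvPolynomial (TZHVar n lam) ℂ)))

/-- A variable as an element of `ℂ(t; z; h)`. -/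
def var (v : TZHVar n lam) : RatTZH n lam := algebraMap (MvPolynomial _ ℂ) _ (MvPolynomial.X (R := ℂ) v)

/-- The weight function
`W_{σ,I}(t; z; h) = W_{σ⁻¹(I)}(t; z_{σ(1)}, …, z_{σ(n)}; h)`, as an element of `ℂ(t; z; h)`. -/
def weightFunction (σ : Equiv.Perm (Fin n)) (I : Partitions n lam) : RatTZH n lam :=
  W (permInv σ I) (fun j a => var (TZHVar.t j a)) (fun a => var (TZHVar.z (σ a))) (var TZHVar.h)

/-- The substitution `t^{(j)} = (z_i)_{i ∈ I_1 ∪ ⋯ ∪ I_j}`, `1 ≤ j ≤ N - 1`, on polynomials. -/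
def substHom (I : Partitions n lam) : MvPolynomial (TZHVar n lam) ℂ →ₐ[ℂ] RatZH n :=
  MvPolynomial.aeval fun v => match v with
    | TZHVar.t j a => zvar (enum I j a)
    | TZHVar.z a => zvar a
    | TZHVar.h => hvar

/-- `f(z_I; z; h)`: the substitution `t^{(j)} = (z_i)_{i ∈ I_1 ∪ ⋯ ∪ I_j}` in a rational
function, written in lowest terms, whose denominator does not vanish under the substitution
(for a polynomial `f` the denominator is a constant). -/
def subst (I : Partitions n lam) (f : RatTZH n lam) : RatZH n :=
  substHom I (IsFractionRing.num (MvPolynomial (TZHVar n lam) ℂ) f) /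
    substHom I (IsFractionRing.den (MvPolynomial (TZHVar n lam) ℂ) f : MvPolynomial _ ℂ)

/-- `R(z_I) = ∏_{a < b} ∏_{i ∈ I_a} ∏_{j ∈ I_b} (z_i - z_j)`. -/
def R (I : Partitions n lam) : RatZH n :=
  ∏ a : Fin N, ∏ b with a < b, ∏ i ∈ block I a, ∏ j ∈ block I b, (zvar i - zvar j)

/-- `Q(z_I) = ∏_{a < b} ∏_{i ∈ I_a} ∏_{j ∈ I_b} (z_i - z_j - h)`. -/
def Q (I : Partitions n lam) : RatZH n :=
  ∏ a : Fin N, ∏ b with a < b, ∏ i ∈ block I a, ∏ j ∈ block I b, (zvar i - zvar j - hvar)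

/-- `c_λ(z_I) = ∏_{a = 1}^{N-1} ∏_{i, j ∈ I_1 ∪ ⋯ ∪ I_a} (z_i - z_j - h)`
(the pairs with `i = j` are included). -/
def c (I : Partitions n lam) : RatZH n :=
  ∏ a ∈ Ico 1 N, ∏ i ∈ blockUnion I a, ∏ j ∈ blockUnion I a, (zvar i - zvar j - hvar)

/-- If `f = p / q` and `q` does not vanish under the substitution, then `subst I f` is the quotient
of the values of `p` and `q`. -/
theorem subst_div (I : Partitions n lam) (p q : MvPolynomial (TZHVar n lam) ℂ)
    (hq : substHom I q ≠ 0) :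
    subst I (algebraMap (MvPolynomial _ ℂ) _ p / algebraMap (MvPolynomial _ ℂ) _ q) = substHom I p / substHom I q := by
  set f : RatTZH n lam := algebraMap _ _ p / algebraMap _ _ q with hf
  have hq0 : q ≠ 0 := by rintro rfl; simp at hq
  have hinj := IsFractionRing.injective (MvPolynomial (TZHVar n lam) ℂ) (RatTZH n lam)
  have hqK : algebraMap _ (RatTZH n lam) q ≠ 0 := by
    simpa using (map_ne_zero_iff _ hinj).2 hq0
  have hdK : algebraMap _ (RatTZH n lam)
      (IsFractionRing.den (MvPolynomial (TZHVar n lam) ℂ) f : MvPolynomial _ ℂ) ≠ 0 :=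
    (map_ne_zero_iff _ hinj).2 (nonZeroDivisors.coe_ne_zero _)
  have hcross : IsFractionRing.num (MvPolynomial (TZHVar n lam) ℂ) f * q =
      p * (IsFractionRing.den (MvPolynomial (TZHVar n lam) ℂ) f : MvPolynomial _ ℂ) := by
    apply hinj
    rw [map_mul, map_mul, ← div_eq_div_iff hdK hqK, ← hf, ← IsFractionRing.mk'_eq_div,
      IsFractionRing.mk'_num_den]
  have hdvd : (IsFractionRing.den (MvPolynomial (TZHVar n lam) ℂ) f : MvPolynomial _ ℂ) ∣ q :=
    (IsFractionRing.num_den_reduced (MvPolynomial (TZHVar n lam) ℂ) f).symm.dvd_of_dvd_mul_left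
      ⟨p, by rw [hcross, mul_comm]⟩
  have hd : substHom I
      (IsFractionRing.den (MvPolynomial (TZHVar n lam) ℂ) f : MvPolynomial _ ℂ) ≠ 0 := by
    obtain ⟨e, he⟩ := hdvd
    intro h0
    exact hq (by rw [he, map_mul, h0, zero_mul])
  unfold subst
  rw [div_eq_div_iff hd hq, ← map_mul, ← map_mul, hcross]

/-- `Regular I f y`: the rational function `f` can be written with a denominator that does not
vanish under the substitution, and `f` takes the value `y`. -/
def Regular (I : Partitions n lam) (f : RatTZH n lam) (y : RatZH n) : Prop :=
  ∃ p q : MvPolynomial (TZHVar n lam) ℂ, substHom I q ≠ 0 ∧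
    f = algebraMap _ _ p / algebraMap _ _ q ∧ y = substHom I p / substHom I q

namespace Regular

variable {I : Partitions n lam} {f g : RatTZH n lam} {x y : RatZH n}

theorem subst_eq (hf : Regular I f x) : subst I f = x := by
  obtain ⟨p, q, hq, rfl, rfl⟩ := hf
  exact subst_div I p q hq

theorem algebraMap_ne_zero {q : MvPolynomial (TZHVar n lam) ℂ} (hq : substHom I q ≠ 0) :
    algebraMap _ (RatTZH n lam) q ≠ 0 := by
  refine (map_ne_zero_iff _ (IsFractionRing.injective _ _)).2 ?_
  rintro rfl
  simp at hq

theorem of_poly (p : MvPolynomial (TZHVar n lam) ℂ) :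
    Regular I (algebraMap _ _ p) (substHom I p) := ⟨p, 1, by simp, by simp, by simp⟩

theorem add (hf : Regular I f x) (hg : Regular I g y) : Regular I (f + g) (x + y) := by
  obtain ⟨p, q, hq, rfl, rfl⟩ := hf
  obtain ⟨r, s, hs, rfl, rfl⟩ := hg
  refine ⟨p * s + q * r, q * s, by simp [hq, hs], ?_, ?_⟩
  · rw [div_add_div _ _ (algebraMap_ne_zero hq) (algebraMap_ne_zero hs)]; simp
  · rw [div_add_div _ _ hq hs]; simp

theorem mul (hf : Regular I f x) (hg : Regular I g y) : Regular I (f * g) (x * y) := by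
  obtain ⟨p, q, hq, rfl, rfl⟩ := hf
  obtain ⟨r, s, hs, rfl, rfl⟩ := hg
  exact ⟨p * r, q * s, by simp [hq, hs], by simp [div_mul_div_comm], by simp [div_mul_div_comm]⟩

theorem neg (hf : Regular I f x) : Regular I (-f) (-x) := by
  obtain ⟨p, q, hq, rfl, rfl⟩ := hf
  exact ⟨-p, q, hq, by rw [map_neg, neg_div], by rw [map_neg, neg_div]⟩

theorem sub (hf : Regular I f x) (hg : Regular I g y) : Regular I (f - g) (x - y) := by
  simpa [sub_eq_add_neg] using hf.add hg.neg

theorem inv (hf : Regular I f x) (hx : x ≠ 0) : Regular I f⁻¹ x⁻¹ := by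
  obtain ⟨p, q, hq, rfl, rfl⟩ := hf
  refine ⟨q, p, ?_, by simp, by simp⟩
  intro h0
  simp [h0] at hx

theorem div (hf : Regular I f x) (hg : Regular I g y) (hy : y ≠ 0) :
    Regular I (f / g) (x / y) := by
  simpa [div_eq_mul_inv] using hf.mul (hg.inv hy)

theorem zero : Regular I 0 0 := by simpa using of_poly (I := I) 0

theorem one : Regular I 1 1 := by simpa using of_poly (I := I) 1

theorem sum {ι : Type*} (s : Finset ι) {F : ι → RatTZH n lam} {X : ι → RatZH n}
    (hF : ∀ i ∈ s, Regular I (F i) (X i)) : Regular I (∑ i ∈ s, F i) (∑ i ∈ s, X i) := by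
  induction s using Finset.cons_induction with
  | empty => simpa using zero
  | cons a s ha ih =>
    rw [Finset.sum_cons, Finset.sum_cons]
    exact (hF a (by simp)).add (ih fun i hi => hF i (by simp [hi]))

theorem prod {ι : Type*} (s : Finset ι) {F : ι → RatTZH n lam} {X : ι → RatZH n}
    (hF : ∀ i ∈ s, Regular I (F i) (X i)) : Regular I (∏ i ∈ s, F i) (∏ i ∈ s, X i) := by
  induction s using Finset.cons_induction with
  | empty => simpa using one
  | cons a s ha ih =>
    rw [Finset.prod_cons, Finset.prod_cons]
    exact (hF a (by simp)).mul (ih fun i hi => hF i (by simp [hi]))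

theorem pow (hf : Regular I f x) (k : ℕ) : Regular I (f ^ k) (x ^ k) := by
  simpa using prod (Finset.range k) (F := fun _ => f) (X := fun _ => x) fun _ _ => hf

end Regular

theorem zvar_injective : Function.Injective (zvar (n := n)) := by
  intro a b hab
  have h1 := MvPolynomial.X_injective
    (IsFractionRing.injective (MvPolynomial (ZHVar n) ℂ) (RatZH n) hab)
  simpa using h1

/-- The substituted weight function is given by the defining formula, evaluated at the substituted
values of the variables; no denominator vanishes there. -/
theorem subst_weightFunction (σ : Equiv.Perm (Fin n)) (I J : Partitions n lam) :
    subst I (weightFunction σ J) =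
      W (permInv σ J) (fun j a => zvar (enum I j a)) (fun a => zvar (σ a)) hvar := by
  apply Regular.subst_eq
  have hv (v : TZHVar n lam) : Regular I (var v) (substHom I (MvPolynomial.X v)) :=
    Regular.of_poly _
  have ht (j : {j // j ∈ Ico 1 N}) (a) : Regular I (var (TZHVar.t j a)) (zvar (enum I j a)) := by
    simpa [substHom] using hv (TZHVar.t j a)
  have hz (a : Fin n) : Regular I (var (TZHVar.z a)) (zvar a) := by
    simpa [substHom] using hv (TZHVar.z a)
  have hh : Regular I (var TZHVar.h) hvar := by simpa [substHom] using hv TZHVar.h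
  refine (hh.neg.pow _).mul (Regular.sum _ fun τ _ => ?_)
  have hl (j : ℕ) (a : Fin (partialSum lam j)) :
      Regular I
        (levels (permInv σ J) (fun j a => var (TZHVar.t j (τ j a)))
          (fun a => var (TZHVar.z (σ a))) j a)
        (levels (permInv σ J) (fun j a => zvar (enum I j (τ j a))) (fun a => zvar (σ a)) j a) := by
    unfold levels
    split_ifs with hj
    · exact ht _ _
    · exact hz _
  refine Regular.prod _ fun j hj => Regular.prod _ fun a _ => ?_
  refine ((Regular.prod _ fun c _ => ((hl _ _).sub (hl _ _)).sub hh).mul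
    (Regular.prod _ fun d _ => (hl _ _).sub (hl _ _))).mul
    (Regular.prod _ fun b hb => (((hl _ _).sub (hl _ _)).sub hh).div ((hl _ _).sub (hl _ _)) ?_)
  rw [sub_ne_zero]
  unfold levels
  rw [dif_pos hj, dif_pos hj]
  intro heq
  have := (τ ⟨j, hj⟩).injective ((enum I j).injective (zvar_injective heq))
  simp [this] at hb

end WeightFn

end

/-!
A weight function depends on the positions `1, …, n` only through their linear order, and the
permutation `σ₀` amounts to reversing that order. If `a` and `b` are neighbouring positions, then
`W_J` satisfies an exchange relation between its values at `z` and at `z` with `z_a` and `z_b`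
interchanged (the action of an R-matrix). This relation for `W_J` and the one for `W_{σ₀,K}` in
the reversed order combine to show that orthogonality for `J` implies orthogonality for `J` with
`a` and `b` interchanged, so `J` may be taken monotone. If `W_J(z_I; z; h)` is nonzero, then the
positions in `J_1 ∪ ⋯ ∪ J_j` can be moved bijectively to those in `I_1 ∪ ⋯ ∪ I_j` without moving
any of them to the right. For monotone `J` this forces `I = J` and, in the reversed order,
`K = J`; the only surviving term is a product over pairs of positions that equals the denominator.
-/

noncomputable section

namespace WeightFn

open Finset

open Equiv (swap)

open OrderDual (toDual ofDual)

section LevelFactor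

variable {α β F : Type*} [LinearOrder α] [LinearOrder β] [Field F]

/-- The factor of `U_J` attached to the variable `u p` of the group `t^{(j)}` at the position `p`
and the variable `y q` of the group `t^{(j+1)}` at the position `q`, variables being indexed by
positions instead of their numbers in `J_1 ∪ ⋯ ∪ J_j`. The factors `-h` at `p = q` account for the
prefactor `(-h)^{λ^{(j)}}` of `W_J`. -/
def crossFactor (h : F) (j : ℕ) (J : α → ℕ) (u y : α → F) (p q : α) : F :=
  if J p < j ∧ J q < j + 1 then
    if p < q then u p - y q else if q < p then u p - y q - h else -h
  else 1

/-- The factor of `U_J` attached to the variables `t^{(j)}` at the positions `p` and `q`. -/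
def selfFactor (h : F) (j : ℕ) (J : α → ℕ) (u : α → F) (p q : α) : F :=
  if J p < j ∧ J q < j ∧ p < q then (u p - u q - h) / (u p - u q) else 1

theorem crossFactor_congr {h : F} {j : ℕ} {J : α → ℕ} {J' : β → ℕ} {u y : α → F} {u' y' : β → F}
    {p q : α} {p' q' : β} (hlt : p < q ↔ p' < q') (hgt : q < p ↔ q' < p')
    (hp : J p < j ↔ J' p' < j) (hq : J q < j + 1 ↔ J' q' < j + 1)
    (hu : J p < j → u p = u' p') (hy : J q < j + 1 → y q = y' q') :
    crossFactor h j J u y p q = crossFactor h j J' u' y' p' q' := by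
  by_cases hJ : J p < j ∧ J q < j + 1
  · simp only [crossFactor, hJ, hp.1 hJ.1, hq.1 hJ.2, hu hJ.1, hy hJ.2, hlt, hgt]
  · rw [crossFactor, crossFactor, if_neg hJ, if_neg (by rwa [← hp, ← hq])]

theorem selfFactor_congr {h : F} {j : ℕ} {J : α → ℕ} {J' : β → ℕ} {u : α → F} {u' : β → F}
    {p q : α} {p' q' : β} (hlt : p < q ↔ p' < q') (hp : J p < j ↔ J' p' < j)
    (hq : J q < j ↔ J' q' < j) (hup : J p < j → u p = u' p') (huq : J q < j → u q = u' q') :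
    selfFactor h j J u p q = selfFactor h j J' u' p' q' := by
  by_cases hJ : J p < j ∧ J q < j ∧ p < q
  · simp only [selfFactor, hJ, hp.1 hJ.1, hq.1 hJ.2.1, hlt.1 hJ.2.2, hup hJ.1, huq hJ.2.1]
  · rw [selfFactor, selfFactor, if_neg hJ, if_neg (by rwa [← hp, ← hq, ← hlt])]

theorem crossFactor_self {h : F} {j : ℕ} {J : α → ℕ} {u y : α → F} {p : α} :
    crossFactor h j J u y p p = if J p < j then -h else 1 := by
  simp only [crossFactor, lt_irrefl, if_false]
  exact if_congr (and_iff_left_of_imp fun hp => hp.trans j.lt_succ_self) rfl rfl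

theorem crossFactor_of_lt {h : F} {j : ℕ} {J : α → ℕ} {u y : α → F} {p q : α}
    (hpq : p < q) :
    crossFactor h j J u y p q = if J p < j ∧ J q < j + 1 then u p - y q else 1 := by
  simp only [crossFactor, hpq, if_true]

theorem crossFactor_of_gt {h : F} {j : ℕ} {J : α → ℕ} {u y : α → F} {p q : α}
    (hpq : q < p) :
    crossFactor h j J u y p q = if J p < j ∧ J q < j + 1 then u p - y q - h else 1 := by
  simp only [crossFactor, hpq, hpq.not_gt, if_true, if_false]

section Swap

variable {a b : α}

theorem swap_mem_pair_iff {p : α} : swap a b p ∈ ({a, b} : Finset α) ↔ p ∈ ({a, b} : Finset α) := by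
  simp only [mem_insert, mem_singleton, Equiv.swap_apply_eq_iff, Equiv.swap_apply_left,
    Equiv.swap_apply_right]
  exact or_comm

theorem swap_apply_lt_iff (hab : a ⋖ b) {p q : α} (hpq : (p, q) ∉ ({a, b} : Finset α) ×ˢ {a, b}) :
    swap a b p < q ↔ p < q := by
  have hlt := hab.lt
  have hcov := @hab.2 q
  simp only [Equiv.swap_apply_def]
  grind

theorem lt_swap_apply_iff (hab : a ⋖ b) {p q : α}
    (hpq : (p, q) ∉ ({a, b} : Finset α) ×ˢ {a, b}) : p < swap a b q ↔ p < q := by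
  have hlt := hab.lt
  have hcov := @hab.2 p
  simp only [Equiv.swap_apply_def]
  grind

theorem swap_apply_lt_swap_apply_iff (hab : a ⋖ b) {p q : α}
    (hpq : (p, q) ∉ ({a, b} : Finset α) ×ˢ {a, b}) : swap a b p < swap a b q ↔ p < q := by
  rw [swap_apply_lt_iff hab, lt_swap_apply_iff hab hpq]
  simpa only [mem_product, swap_mem_pair_iff] using hpq

theorem apply_swap_lt_iff {J : α → ℕ} {j : ℕ} (ha : J a < j) (hb : J b < j) (p : α) :
    J (swap a b p) < j ↔ J p < j := by
  rw [Equiv.swap_apply_def]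
  split_ifs <;> simp_all only

theorem prod_compl_pair_comp {M : Type*} [CommMonoid M] [Fintype α] (σ τ : Equiv.Perm α)
    (hσ : ∀ p, σ p ∈ ({a, b} : Finset α) ↔ p ∈ ({a, b} : Finset α))
    (hτ : ∀ p, τ p ∈ ({a, b} : Finset α) ↔ p ∈ ({a, b} : Finset α)) (f : α → α → M) :
    ∏ x ∈ (({a, b} : Finset α) ×ˢ {a, b})ᶜ, f (σ x.1) (τ x.2) =
      ∏ x ∈ (({a, b} : Finset α) ×ˢ {a, b})ᶜ, f x.1 x.2 :=
  prod_equiv (σ.prodCongr τ)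
    (fun x => by
      simp only [mem_compl, mem_product, Equiv.prodCongr_apply, Prod.map_fst, Prod.map_snd, hσ, hτ])
    fun _ _ => rfl

end Swap

variable [Fintype α]

/-- The part of `(-h)^{λ^{(1)} + ⋯ + λ^{(N-1)}} U_J` with a given `j`, where `u` stands for
`t^{(j)}` and `y` for `t^{(j+1)}`, both indexed by positions. -/
def levelFactor (h : F) (j : ℕ) (J : α → ℕ) (u y : α → F) : F :=
  ∏ x : α × α, crossFactor h j J u y x.1 x.2 * selfFactor h j J u x.1 x.2

variable {h : F} {j : ℕ} {J : α → ℕ} {u y : α → F}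

theorem levelFactor_zero : levelFactor h 0 J u y = 1 := by
  simp [levelFactor, crossFactor, selfFactor]

theorem levelFactor_comp_orderIso [Fintype β] (e : β ≃o α) :
    levelFactor h j (J ∘ e) (u ∘ e) (y ∘ e) = levelFactor h j J u y := by
  refine Fintype.prod_equiv (e.toEquiv.prodCongr e.toEquiv) _ _ fun x => ?_
  congr 1
  · exact crossFactor_congr e.lt_iff_lt.symm e.lt_iff_lt.symm .rfl .rfl (fun _ => rfl) fun _ => rfl
  · exact selfFactor_congr e.lt_iff_lt.symm .rfl .rfl (fun _ => rfl) fun _ => rfl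

theorem levelFactor_congr {J' : α → ℕ} {u' y' : α → F} (hJ : ∀ p, J p < j ↔ J' p < j)
    (hJ' : ∀ p, J p < j + 1 ↔ J' p < j + 1) (hu : ∀ p, J p < j → u p = u' p)
    (hy : ∀ p, J p < j + 1 → y p = y' p) : levelFactor h j J u y = levelFactor h j J' u' y' := by
  refine Fintype.prod_congr _ _ fun x => ?_
  rw [crossFactor_congr .rfl .rfl (hJ x.1) (hJ' x.2) (hu x.1) (hy x.2),
    selfFactor_congr .rfl (hJ x.1) (hJ x.2) (hu x.1) (hu x.2)]

section Adjacent

variable {a b : α}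

/-- The factors of `levelFactor` that involve a position other than `a` and `b`. -/
def levelRest (h : F) (j : ℕ) (a b : α) (J : α → ℕ) (u y : α → F) : F :=
  ∏ x ∈ (({a, b} : Finset α) ×ˢ {a, b})ᶜ,
    crossFactor h j J u y x.1 x.2 * selfFactor h j J u x.1 x.2

theorem levelFactor_eq_mul_levelRest (hab : a < b) :
    levelFactor h j J u y =
      (if J a < j then -h else 1) * (if J b < j then -h else 1) *
        (if J a < j ∧ J b < j + 1 then u a - y b else 1) *
        (if J b < j ∧ J a < j + 1 then u b - y a - h else 1) *
        (if J a < j ∧ J b < j then (u a - u b - h) / (u a - u b) else 1) *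
        levelRest h j a b J u y := by
  rw [levelFactor, ← prod_mul_prod_compl (({a, b} : Finset α) ×ˢ {a, b}), ← levelRest]
  simp only [prod_product, prod_pair hab.ne, crossFactor_self, crossFactor_of_lt hab,
    crossFactor_of_gt hab, selfFactor, lt_irrefl, hab, hab.not_gt, and_true, and_false, if_false]
  ring

theorem levelRest_comp_swap (hab : a ⋖ b) :
    levelRest h j a b (J ∘ swap a b) (u ∘ swap a b) (y ∘ swap a b) = levelRest h j a b J u y := by
  rw [levelRest, levelRest, ← prod_compl_pair_comp (swap a b) (swap a b)
    (fun _ => swap_mem_pair_iff) (fun _ => swap_mem_pair_iff)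
    (fun p q => crossFactor h j J u y p q * selfFactor h j J u p q)]
  refine prod_congr rfl fun x hx => ?_
  have hx' : (x.2, x.1) ∉ ({a, b} : Finset α) ×ˢ {a, b} := by
    simpa only [mem_compl, mem_product, and_comm] using hx
  have hlt := (swap_apply_lt_swap_apply_iff hab (mem_compl.1 hx)).symm
  have hgt := (swap_apply_lt_swap_apply_iff hab hx').symm
  congr 1
  · exact crossFactor_congr hlt hgt .rfl .rfl (fun _ => rfl) fun _ => rfl
  · exact selfFactor_congr hlt .rfl .rfl (fun _ => rfl) fun _ => rfl

theorem levelRest_comp_swap_right (hab : a ⋖ b) (ha : J a < j + 1) (hb : J b < j + 1) :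
    levelRest h j a b J u (y ∘ swap a b) = levelRest h j a b J u y := by
  rw [levelRest, levelRest, prod_mul_distrib, prod_mul_distrib]
  congr 1
  rw [← prod_compl_pair_comp 1 (swap a b) (fun _ => .rfl) (fun _ => swap_mem_pair_iff)
    (crossFactor h j J u y)]
  refine prod_congr rfl fun x hx => ?_
  have hx' : (x.2, x.1) ∉ ({a, b} : Finset α) ×ˢ {a, b} := by
    simpa only [mem_compl, mem_product, and_comm] using hx
  exact crossFactor_congr (lt_swap_apply_iff hab (mem_compl.1 hx)).symm
    (swap_apply_lt_iff hab hx').symm .rfl (apply_swap_lt_iff ha hb _).symm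
    (fun _ => rfl) fun _ => rfl

theorem levelRest_comp_swap_left (hab : a ⋖ b) (ha : J a < j) (hb : J b < j) :
    levelRest h j a b J (u ∘ swap a b) y = levelRest h j a b J u y := by
  have hrest : levelRest h j a b J (u ∘ swap a b) (y ∘ swap a b) =
      levelRest h j a b (J ∘ swap a b) (u ∘ swap a b) (y ∘ swap a b) := by
    refine prod_congr rfl fun x _ => ?_
    congr 1
    · exact crossFactor_congr .rfl .rfl (apply_swap_lt_iff ha hb _).symm
        (apply_swap_lt_iff (j := j + 1) (by lia) (by lia) _).symm (fun _ => rfl) fun _ => rfl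
    · exact selfFactor_congr .rfl (apply_swap_lt_iff ha hb _).symm (apply_swap_lt_iff ha hb _).symm
        (fun _ => rfl) fun _ => rfl
  rw [← levelRest_comp_swap_right hab (by lia) (by lia), hrest, levelRest_comp_swap hab]

theorem levelFactor_comp_swap (hab : a ⋖ b) (hJ : ¬(J a < j + 1 ∧ J b < j + 1)) :
    levelFactor h j (J ∘ swap a b) (u ∘ swap a b) (y ∘ swap a b) = levelFactor h j J u y := by
  have hab' : ¬(J a < j ∧ J b < j + 1) := by lia
  have hba' : ¬(J b < j ∧ J a < j + 1) := by lia
  have hab'' : ¬(J a < j ∧ J b < j) := by lia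
  have hba'' : ¬(J b < j ∧ J a < j) := by lia
  simp only [levelFactor_eq_mul_levelRest hab.lt, levelRest_comp_swap hab, Function.comp_apply,
    Equiv.swap_apply_left, Equiv.swap_apply_right, hab', hba', hab'', hba'', if_false]
  ring

theorem levelFactor_exchange (hab : a ⋖ b) (ha : J a < j + 1) (hb : J b < j + 1)
    (hJ : ¬(J a < j ∧ J b < j)) :
    (y a - y b + h) * levelFactor h j J u (y ∘ swap a b) =
      h * levelFactor h j J u y +
        (y a - y b) * levelFactor h j (J ∘ swap a b) (u ∘ swap a b) y := by
  have hrest : levelRest h j a b (J ∘ swap a b) (u ∘ swap a b) y = levelRest h j a b J u y := by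
    rw [← levelRest_comp_swap_right (y := y) hab (by simpa using hb) (by simpa using ha),
      levelRest_comp_swap hab]
  have hJ' : ¬(J b < j ∧ J a < j) := by rwa [and_comm]
  simp only [levelFactor_eq_mul_levelRest hab.lt, levelRest_comp_swap_right hab ha hb, hrest,
    Function.comp_apply, Equiv.swap_apply_left, Equiv.swap_apply_right, ha, hb, hJ, hJ', and_true,
    if_false]
  split_ifs <;> first | lia | ring

theorem levelFactor_exchange_of_lt (hab : a ⋖ b) (ha : J a < j) (hb : J b < j) (hu : u a ≠ u b) :
    (y a - y b + h) * levelFactor h j J u (y ∘ swap a b) =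
      h * levelFactor h j J u y +
        (y a - y b) * (((u a - u b - h) * levelFactor h j J (u ∘ swap a b) y -
          h * levelFactor h j J u y) / (u a - u b)) := by
  have hd : u a - u b ≠ 0 := sub_ne_zero.2 hu
  have hd' : u b - u a ≠ 0 := sub_ne_zero.2 hu.symm
  have ha' : J a < j + 1 := ha.trans j.lt_succ_self
  have hb' : J b < j + 1 := hb.trans j.lt_succ_self
  simp only [levelFactor_eq_mul_levelRest hab.lt, levelRest_comp_swap_left hab ha hb,
    levelRest_comp_swap_right hab ha' hb', Function.comp_apply, Equiv.swap_apply_left,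
    Equiv.swap_apply_right, ha, hb, ha', hb', and_self, if_true]
  field_simp
  ring

end Adjacent

end LevelFactor

section WeightSum

variable {α β F : Type*} [LinearOrder α] [LinearOrder β] [Fintype α] [Fintype β] [Field F]
  {ι ι' : ℕ → Type*} [∀ j, Fintype (ι j)] [∀ j, DecidableEq (ι j)]
  [∀ j, Fintype (ι' j)] [∀ j, DecidableEq (ι' j)]

/-- The variables `t` placed at the positions in `J_1 ∪ ⋯ ∪ J_j` according to the numbering `e`,
with the junk value `0` at the other positions. -/
def labelling {α ι F : Type*} [Zero F] {J : α → ℕ} {j : ℕ} (t : ι → F) (e : {p // J p < j} ≃ ι)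
    (p : α) : F :=
  if hp : J p < j then t (e ⟨p, hp⟩) else 0

theorem labelling_of_lt {α ι F : Type*} [Zero F] {J : α → ℕ} {j : ℕ} {t : ι → F}
    {e : {p // J p < j} ≃ ι} {p : α} (hp : J p < j) : labelling t e p = t (e ⟨p, hp⟩) :=
  dif_pos hp

theorem sum_labelling_comp {κ : Type*} [Fintype κ] [DecidableEq κ] {J : α → ℕ} {J' : β → ℕ}
    {j : ℕ} {s : β ≃ α} (hs : ∀ p, J' p < j ↔ J (s p) < j) (t : κ → F) (f : (β → F) → F) :
    ∑ e : {p // J' p < j} ≃ κ, f (labelling t e) =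
      ∑ e : {p // J p < j} ≃ κ, f (labelling t e ∘ s) := by
  rw [← Equiv.sum_comp (Equiv.equivCongr (s.subtypeEquiv (q := fun p => J p < j) hs).symm
    (Equiv.refl κ))]
  refine Fintype.sum_congr _ _ fun e => congrArg f (funext fun p => ?_)
  exact dite_congr (propext (hs p)) (fun _ => rfl) fun _ => rfl

/-- The weight function `W_J` built from the levels below `j` only, with `y` in the place of
`t^{(j)}`. Symmetrization in `t^{(i)}` becomes the sum over all numberings of the positions in
`J_1 ∪ ⋯ ∪ J_i`, so that `J` may be defined on any finite linear order of positions. -/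
def weightSum (h : F) (t : ∀ j, ι j → F) (J : α → ℕ) : ℕ → (α → F) → F
  | 0, _ => 1
  | j + 1, y => ∑ e : {p // J p < j} ≃ ι j,
      levelFactor h j J (labelling (t j) e) y * weightSum h t J j (labelling (t j) e)

variable {h : F} {t : ∀ j, ι j → F} {J : α → ℕ} {j : ℕ} {y : α → F}

theorem weightSum_comp_succ (s : β ≃ α) {y : β → F} :
    weightSum h t (J ∘ s) (j + 1) y = ∑ e : {p // J p < j} ≃ ι j,
      levelFactor h j (J ∘ s) (labelling (t j) e ∘ s) y *
        weightSum h t (J ∘ s) j (labelling (t j) e ∘ s) :=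
  sum_labelling_comp (s := s) (fun _ => .rfl) (t j) fun u =>
    levelFactor h j (J ∘ s) u y * weightSum h t (J ∘ s) j u

theorem weightSum_congr {y' : α → F} (hy : ∀ p, J p < j → y p = y' p) :
    weightSum h t J j y = weightSum h t J j y' := by
  cases j with
  | zero => rfl
  | succ j =>
    exact Fintype.sum_congr _ _ fun _ => congrArg (· * _)
      (levelFactor_congr (fun _ => .rfl) (fun _ => .rfl) (fun _ _ => rfl) hy)

theorem weightSum_comp_orderIso (e : β ≃o α) :
    weightSum h t (J ∘ e) j (y ∘ e) = weightSum h t J j y := by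
  induction j generalizing y with
  | zero => rfl
  | succ j ih =>
    refine (weightSum_comp_succ e.toEquiv).trans ?_
    exact Fintype.sum_congr _ _ fun e' => congrArg₂ _ (levelFactor_comp_orderIso e) ih

theorem weightSum_comp_equiv (ε : ∀ j, ι' j ≃ ι j) :
    weightSum h (fun j => t j ∘ ε j) J j y = weightSum h t J j y := by
  induction j generalizing y with
  | zero => rfl
  | succ j ih =>
    rw [weightSum, weightSum, ← Equiv.sum_comp (Equiv.equivCongr (Equiv.refl _) (ε j))]
    exact Fintype.sum_congr _ _ fun e => congrArg _ ih

section Adjacent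

variable {a b : α}

theorem weightSum_comp_swap (hab : a ⋖ b) (hJ : ¬(J a < j ∧ J b < j)) :
    weightSum h t (J ∘ swap a b) j (y ∘ swap a b) = weightSum h t J j y := by
  induction j generalizing y with
  | zero => rfl
  | succ j ih =>
    rw [weightSum_comp_succ]
    exact Fintype.sum_congr _ _ fun e =>
      congrArg₂ _ (levelFactor_comp_swap hab hJ) (ih (by lia))

theorem weightSum_succ_comp_swap (hab : a ⋖ b) (ht : Function.Injective (t j)) (ha : J a < j)
    (hb : J b < j)
    (hexch : ∀ u : α → F, (u a - u b + h) * weightSum h t J j (u ∘ swap a b) =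
      h * weightSum h t J j u + (u a - u b) * weightSum h t (J ∘ swap a b) j u) :
    weightSum h t (J ∘ swap a b) (j + 1) y = ∑ e : {p // J p < j} ≃ ι j,
      let u := labelling (t j) e
      ((u a - u b - h) * levelFactor h j J (u ∘ swap a b) y - h * levelFactor h j J u y) /
        (u a - u b) * weightSum h t J j u := by
  have hne (e : {p // J p < j} ≃ ι j) : labelling (t j) e a - labelling (t j) e b ≠ 0 := by
    simpa [labelling, ha, hb, sub_eq_zero, ht.eq_iff] using hab.ne
  have hmem := apply_swap_lt_iff ha hb
  have hlevel (u : α → F) : levelFactor h j (J ∘ swap a b) u y = levelFactor h j J u y :=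
    levelFactor_congr hmem (apply_swap_lt_iff (by lia) (by lia)) (fun _ _ => rfl) fun _ _ => rfl
  have hshift := sum_labelling_comp (s := swap a b) (fun p => (hmem p).symm) (t j) fun u =>
    h / (u b - u a) * (levelFactor h j J u y * weightSum h t J j u)
  simp only [Function.comp_apply, Equiv.swap_apply_left, Equiv.swap_apply_right] at hshift
  -- The sum over numberings is split with the exchange relation one level below; in the part
  -- containing `u ∘ swap a b`, `hshift` interchanges the numbers of `a` and `b`.
  have hsplit (e : {p // J p < j} ≃ ι j) : let u := labelling (t j) e
      levelFactor h j J (u ∘ swap a b) y * weightSum h t (J ∘ swap a b) j (u ∘ swap a b) =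
        (u a - u b - h) / (u a - u b) * (levelFactor h j J (u ∘ swap a b) y * weightSum h t J j u) +
          h / (u a - u b) *
            (levelFactor h j J (u ∘ swap a b) y * weightSum h t J j (u ∘ swap a b)) := by
    intro u
    have hu := hexch (u ∘ swap a b)
    rw [show (u ∘ swap a b) ∘ swap a b = u by ext p; simp] at hu
    simp only [Function.comp_apply, Equiv.swap_apply_left, Equiv.swap_apply_right] at hu
    have hd : u a - u b ≠ 0 := hne e
    field_simp
    linear_combination levelFactor h j J (u ∘ swap a b) y * hu
  rw [weightSum_comp_succ]
  simp only [hlevel, hsplit, sum_add_distrib, ← hshift]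
  rw [← sum_add_distrib]
  refine Fintype.sum_congr _ _ fun e => ?_
  have := hne e
  rw [← neg_sub (labelling (t j) e a)]
  field_simp
  ring

theorem weightSum_exchange (hab : a ⋖ b) (ht : ∀ j, Function.Injective (t j)) (ha : J a < j)
    (hb : J b < j) :
    (y a - y b + h) * weightSum h t J j (y ∘ swap a b) =
      h * weightSum h t J j y + (y a - y b) * weightSum h t (J ∘ swap a b) j y := by
  induction j generalizing y with
  | zero => lia
  | succ j ih =>
    by_cases hJ : J a < j ∧ J b < j
    · rw [weightSum_succ_comp_swap hab (ht j) hJ.1 hJ.2 fun _ => ih hJ.1 hJ.2]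
      simp only [weightSum, mul_sum, ← sum_add_distrib]
      refine Fintype.sum_congr _ _ fun e => ?_
      have hne : labelling (t j) e a ≠ labelling (t j) e b := by
        simpa [labelling, hJ.1, hJ.2, (ht j).eq_iff] using hab.ne
      rw [← mul_assoc, levelFactor_exchange_of_lt hab hJ.1 hJ.2 hne]
      ring
    · rw [weightSum_comp_succ]
      simp only [weightSum, mul_sum, ← sum_add_distrib]
      refine Fintype.sum_congr _ _ fun e => ?_
      rw [weightSum_comp_swap hab hJ, ← mul_assoc, levelFactor_exchange hab ha hb hJ]
      ring

end Adjacent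

end WeightSum

section Triangularity

variable {α F : Type*} [LinearOrder α] [Fintype α] [Field F] {h : F} {z u y : α → F}
  {I J : α → ℕ} {i j N : ℕ}

theorem equiv_refl_of_apply_le {α : Type*} [PartialOrder α] [WellFoundedLT α] {p : α → Prop}
    (e : Equiv.Perm {a // p a})
    (he : ∀ a, e a ≤ a) : e = Equiv.refl _ := by
  ext a
  induction a using WellFoundedLT.induction with
  | ind a ih =>
    refine congrArg Subtype.val ((he a).eq_or_lt.resolve_right fun hlt => ?_)
    exact hlt.ne (e.injective (Subtype.ext (ih _ hlt)))

theorem iff_of_equiv_of_imp {α : Type*} [Finite α] {P Q : α → Prop} (e : Subtype P ≃ Subtype Q)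
    (hPQ : ∀ p, P p → Q p) (p : α) : P p ↔ Q p :=
  Set.ext_iff.1 (Set.eq_of_subset_of_ncard_le (s := {p | P p}) (t := {p | Q p}) hPQ
    (Nat.card_congr e.symm).le) p

theorem le_of_levelFactor_ne_zero (hne : levelFactor h j J u y ≠ 0) {p q : α} (hp : J p < j)
    (hq : J q < j + 1) (huy : u p = y q) : q ≤ p := by
  by_contra! hpq
  refine hne (prod_eq_zero (mem_univ (p, q)) ?_)
  rw [crossFactor_of_lt hpq, if_pos ⟨hp, hq⟩, huy, sub_self, zero_mul]

/-- The value `W_J(z_I; z; h)`. -/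
def weightAt (h : F) (z : α → F) (J I : α → ℕ) (N : ℕ) : F :=
  weightSum h (fun j (p : {p // I p < j}) => z p) J N z

theorem exists_equiv_le_of_weightSum_ne_zero {f : {p // J p < j} ≃ {p // I p < j}}
    (hf : ∀ p, (f p : α) ≤ p)
    (hne : weightSum h (fun j (p : {p // I p < j}) => z p) J j
      (labelling (fun p : {p // I p < j} => z p) f) ≠ 0) (hij : i ≤ j) :
    ∃ e : {p // J p < i} ≃ {p // I p < i}, ∀ p, (e p : α) ≤ p := by
  induction j with
  | zero => exact Nat.le_zero.1 hij ▸ ⟨f, hf⟩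
  | succ j ih =>
    obtain rfl | hij := hij.eq_or_lt
    · exact ⟨f, hf⟩
    obtain ⟨e, -, he⟩ := exists_ne_zero_of_sum_ne_zero hne
    refine ih (f := e) (fun p => ?_) (right_ne_zero_of_mul he) (Nat.lt_succ_iff.1 hij)
    obtain ⟨q, hq⟩ := f.surjective ⟨e p, (e p).2.trans j.lt_succ_self⟩
    have hval : (f q : α) = e p := congrArg Subtype.val hq
    have hqp : (q : α) ≤ p := le_of_levelFactor_ne_zero (left_ne_zero_of_mul he) p.2 q.2 <| by
      rw [labelling_of_lt p.2, labelling_of_lt q.2, hval]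
    exact hval ▸ (hf q).trans hqp

theorem exists_equiv_le_of_weightAt_ne_zero (hJ : ∀ p, J p < N) (hI : ∀ p, I p < N)
    (hne : weightAt h z J I N ≠ 0) (hj : j ≤ N) :
    ∃ e : {p // J p < j} ≃ {p // I p < j}, ∀ p, (e p : α) ≤ p := by
  let f : {p // J p < N} ≃ {p // I p < N} :=
    Equiv.subtypeEquivRight fun p => iff_of_true (hJ p) (hI p)
  refine exists_equiv_le_of_weightSum_ne_zero (f := f) (h := h) (z := z) (fun p => le_rfl) ?_ hj
  rwa [weightAt, weightSum_congr fun p hp =>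
    (labelling_of_lt (t := fun p : {p // I p < N} => z p) (e := f) hp).symm] at hne

theorem eq_of_forall_lt_iff_lt {α : Type*} {I J : α → ℕ} (hJ : ∀ p, J p < N) (hI : ∀ p, I p < N)
    (hJI : ∀ j ≤ N, ∀ p, J p < j ↔ I p < j) : J = I := by
  ext p
  have := hJI (J p + 1) (hJ p) p
  have := hJI (I p + 1) (hI p) p
  lia

theorem eq_of_monotone_of_weightAt_ne_zero (hJ : ∀ p, J p < N) (hI : ∀ p, I p < N)
    (hmono : Monotone J) (hne : weightAt h z J I N ≠ 0) : J = I := by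
  refine eq_of_forall_lt_iff_lt hJ hI fun j hj p => ?_
  obtain ⟨e, he⟩ := exists_equiv_le_of_weightAt_ne_zero hJ hI hne hj
  refine (iff_of_equiv_of_imp e.symm (fun q hq => ?_) p).symm
  have hle : q ≤ e.symm ⟨q, hq⟩ := by simpa using he (e.symm ⟨q, hq⟩)
  exact (hmono hle).trans_lt (e.symm ⟨q, hq⟩).2

theorem eq_of_antitone_of_weightAt_ne_zero (hJ : ∀ p, J p < N) (hI : ∀ p, I p < N)
    (hanti : Antitone I) (hne : weightAt h z J I N ≠ 0) : J = I := by
  refine eq_of_forall_lt_iff_lt hJ hI fun j hj p => ?_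
  obtain ⟨e, he⟩ := exists_equiv_le_of_weightAt_ne_zero hJ hI hne hj
  exact iff_of_equiv_of_imp e (fun q hq => (hanti (he ⟨q, hq⟩)).trans_lt (e ⟨q, hq⟩).2) p

theorem weightAt_self : weightAt h z J J N = ∏ j ∈ range N, levelFactor h j J z z := by
  unfold weightAt
  induction N with
  | zero => rfl
  | succ j ih =>
    have hlab (p : α) (hp : J p < j) :
        labelling (fun p : {p // J p < j} => z p) (Equiv.refl _) p = z p := labelling_of_lt hp
    rw [weightSum, Fintype.sum_eq_single (Equiv.refl _), weightSum_congr hlab, ih,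
      levelFactor_congr (fun _ => .rfl) (fun _ => .rfl) hlab fun _ _ => rfl, prod_range_succ_comm]
    intro e he
    refine mul_eq_zero_of_left (by_contra fun hne => he (equiv_refl_of_apply_le e fun p => ?_)) _
    exact le_of_levelFactor_ne_zero hne p.2 ((e p).2.trans j.lt_succ_self) (labelling_of_lt p.2)

end Triangularity

section Diagonal

variable {α F : Type*} [LinearOrder α] [Field F] {h : F} {z : α → F}
  {I : α → ℕ} {j N : ℕ}

theorem crossFactor_mul_toDual (p q : α) :
    crossFactor h j I z z p q *
        crossFactor h j (I ∘ ofDual) (z ∘ ofDual) (z ∘ ofDual) (toDual p) (toDual q) =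
      if I p < j ∧ I q < j + 1 then
        if p = q then h ^ 2 else (z p - z q) * (z p - z q - h)
      else 1 := by
  simp only [crossFactor, Function.comp_apply, OrderDual.ofDual_toDual, OrderDual.toDual_lt_toDual]
  by_cases hI : I p < j ∧ I q < j + 1
  · simp only [hI, if_true, and_self]
    obtain hpq | rfl | hpq := lt_trichotomy p q
    · simp only [hpq, hpq.not_gt, hpq.ne, if_true, if_false]
    · simp only [lt_irrefl, if_true, if_false, neg_mul_neg, sq]
    · simp only [hpq, hpq.not_gt, hpq.ne', if_true, if_false, mul_comm]
  · simp only [hI, if_false, mul_one]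

theorem selfFactor_mul_toDual (p q : α) :
    selfFactor h j I z p q * selfFactor h j (I ∘ ofDual) (z ∘ ofDual) (toDual p) (toDual q) =
      if I p < j ∧ I q < j ∧ p ≠ q then (z p - z q - h) / (z p - z q) else 1 := by
  simp only [selfFactor, Function.comp_apply, OrderDual.ofDual_toDual, OrderDual.toDual_lt_toDual]
  obtain hpq | rfl | hpq := lt_trichotomy p q
  · simp only [hpq, hpq.not_gt, hpq.ne, ne_eq, not_false_eq_true, and_true, and_false, if_false,
      mul_one]
  · simp only [lt_irrefl, ne_eq, not_true_eq_false, and_false, if_false, mul_one]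
  · simp only [hpq, hpq.not_gt, hpq.ne', ne_eq, not_false_eq_true, and_true, and_false, if_false,
      one_mul]

theorem crossFactor_mul_selfFactor_mul_toDual (hz : Function.Injective z) (p q : α) :
    crossFactor h j I z z p q * selfFactor h j I z p q *
        (crossFactor h j (I ∘ ofDual) (z ∘ ofDual) (z ∘ ofDual) (toDual p) (toDual q) *
          selfFactor h j (I ∘ ofDual) (z ∘ ofDual) (toDual p) (toDual q)) =
      (if I p < j ∧ I q = j then (z p - z q) * (z p - z q - h) else 1) *
        (if I p < j ∧ I q < j then z p - z q - h else 1) ^ 2 := by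
  rw [mul_mul_mul_comm, crossFactor_mul_toDual, selfFactor_mul_toDual]
  by_cases hp : I p < j
  · obtain rfl | hpq := eq_or_ne p q
    · simp [hp, hp.ne, hp.trans j.lt_succ_self]
    · have hne : z p - z q ≠ 0 := sub_ne_zero.2 (hz.ne hpq)
      obtain hq | hq | hq := lt_trichotomy (I q) j
      · simp only [hp, hq, hq.ne, hq.trans j.lt_succ_self, hpq, ne_eq, not_false_eq_true, and_self,
          and_false, if_true, if_false]
        field_simp
      · simp [hp, hq, hpq]
      · simp [hq.ne', hq.not_gt, hq.not_ge]
  · simp [hp]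

variable [Fintype α]

/-- The denominator `R(z_I) Q(z_I) c_λ(z_I)²`, up to the factor `1` for `j = 0`. -/
def pairingDenom {α F : Type*} [Fintype α] [Field F] (h : F) (z : α → F) (I : α → ℕ) (N : ℕ) : F :=
  (∏ x : α × α with I x.1 < I x.2, (z x.1 - z x.2) * (z x.1 - z x.2 - h)) *
    (∏ j ∈ range N, ∏ x : α × α with I x.1 < j ∧ I x.2 < j, (z x.1 - z x.2 - h)) ^ 2

theorem pairingDenom_ne_zero {α : Type*} [Fintype α] {z : α → F} {I : α → ℕ}
    (hz : Function.Injective z) (hh : ∀ p q, z p - z q ≠ h) : pairingDenom h z I N ≠ 0 := by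
  refine mul_ne_zero (prod_ne_zero_iff.2 fun x hx => ?_)
    (pow_ne_zero _ (prod_ne_zero_iff.2 fun j _ => prod_ne_zero_iff.2 fun x _ => ?_))
  · refine mul_ne_zero (sub_ne_zero.2 (hz.ne fun heq => ?_)) (sub_ne_zero.2 (hh _ _))
    exact (heq ▸ (mem_filter.1 hx).2).false
  · exact sub_ne_zero.2 (hh _ _)

theorem pairingDenom_comp_equiv {α β : Type*} [Fintype α] [Fintype β] {z : α → F} {I : α → ℕ}
    (s : β ≃ α) : pairingDenom h (z ∘ s) (I ∘ s) N = pairingDenom h z I N := by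
  have hprod (P : α × α → Prop) [DecidablePred P] (f : α × α → F) :
      ∏ x : β × β with P (s x.1, s x.2), f (s x.1, s x.2) = ∏ x with P x, f x := by
    simp only [prod_filter]
    exact Equiv.prod_comp (s.prodCongr s) fun x => if P x then f x else 1
  exact congrArg₂ (· * · ^ 2)
    (hprod (fun x => I x.1 < I x.2) fun x => (z x.1 - z x.2) * (z x.1 - z x.2 - h))
    (prod_congr rfl fun j _ =>
      hprod (fun x => I x.1 < j ∧ I x.2 < j) fun x => z x.1 - z x.2 - h)

theorem levelFactor_mul_toDual (hz : Function.Injective z) :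
    levelFactor h j I z z * levelFactor h j (I ∘ ofDual) (z ∘ ofDual) (z ∘ ofDual) =
      (∏ x : α × α, if I x.1 < j ∧ I x.2 = j then (z x.1 - z x.2) * (z x.1 - z x.2 - h) else 1) *
        (∏ x : α × α with I x.1 < j ∧ I x.2 < j, (z x.1 - z x.2 - h)) ^ 2 := by
  rw [levelFactor, levelFactor, ← Equiv.prod_comp (toDual.prodCongr toDual), prod_filter,
    ← prod_pow, ← prod_mul_distrib, ← prod_mul_distrib]
  exact Fintype.prod_congr _ _ fun x => crossFactor_mul_selfFactor_mul_toDual hz x.1 x.2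

theorem weightAt_self_mul_toDual (hz : Function.Injective z) (hI : ∀ p, I p < N) :
    weightAt h z I I N * weightAt h (z ∘ ofDual) (I ∘ ofDual) (I ∘ ofDual) N =
      pairingDenom h z I N := by
  have hcross (x : α × α) :
      (∏ j ∈ range N, if I x.1 < j ∧ I x.2 = j then (z x.1 - z x.2) * (z x.1 - z x.2 - h) else 1) =
        if I x.1 < I x.2 then (z x.1 - z x.2) * (z x.1 - z x.2 - h) else 1 := by
    simp only [and_comm (a := I x.1 < _), ite_and, prod_ite_eq, mem_range, hI, if_true]
  rw [weightAt_self, weightAt_self, ← prod_mul_distrib]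
  simp only [levelFactor_mul_toDual hz, prod_mul_distrib, prod_pow]
  rw [prod_comm]
  simp only [hcross, pairingDenom, prod_filter]

end Diagonal

section SumPi

variable {α F : Type*} [Field F] {ι : ℕ → Type*} {t : ∀ j, ι j → F} {J : α → ℕ} {z : α → F}
  {N : ℕ}

/-- Splitting off the last member of a family indexed by `1, …, N`. -/
def piIcoSuccEquiv (X : ℕ → Type*) (hN : 1 ≤ N) :
    X N × (∀ j : {j // j ∈ Ico 1 N}, X j) ≃ (∀ j : {j // j ∈ Ico 1 (N + 1)}, X j) where
  toFun x j :=
    if hj : j.1 = N then cast (congrArg X hj.symm) x.1 else x.2 ⟨j, by grind⟩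
  invFun x := (x ⟨N, by grind⟩, fun j => x ⟨j, by grind⟩)
  left_inv x := by
    ext j
    · simp
    · have hj := (mem_Ico.1 j.2).2.ne
      simp [hj]
  right_inv x := by
    ext ⟨j, hj⟩
    obtain rfl | hne := eq_or_ne j N
    · simp
    · simp [hne]

/-- The variables `t^{(1)}, …, t^{(N-1)}` placed at positions according to a family of numberings,
together with `z` in the place of all other levels. -/
def familyLabelling (t : ∀ j, ι j → F) (z : α → F)
    (e : ∀ j : {j // j ∈ Ico 1 N}, {p // J p < j} ≃ ι j) (j : ℕ) : α → F :=
  if hj : j ∈ Ico 1 N then labelling (t j) (e ⟨j, hj⟩) else z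

theorem familyLabelling_piIcoSuccEquiv (hN : 1 ≤ N)
    (e : ({p // J p < N} ≃ ι N) × ∀ j : {j // j ∈ Ico 1 N}, {p // J p < j} ≃ ι j) {j : ℕ}
    (hj : j ∈ Icc 1 N) :
    familyLabelling t z (piIcoSuccEquiv (fun j => {p // J p < j} ≃ ι j) hN e) j =
      familyLabelling t (labelling (t N) e.1) e.2 j := by
  obtain ⟨hj1, hjN⟩ := mem_Icc.1 hj
  obtain rfl | hlt := hjN.eq_or_lt
  · simp [familyLabelling, piIcoSuccEquiv, hj1]
  · simp [familyLabelling, piIcoSuccEquiv, hj1, hlt, hlt.ne, hlt.trans N.lt_succ_self]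

variable [LinearOrder α] [Fintype α] [∀ j, Fintype (ι j)] [∀ j, DecidableEq (ι j)]
  [IsEmpty (ι 0)] {h : F}

theorem weightSum_of_le_one (hN : N ≤ 1) : weightSum h t J N z = 1 := by
  interval_cases N
  · rfl
  · have : IsEmpty {p // J p < 0} := ⟨fun p => Nat.not_lt_zero _ p.2⟩
    have : Unique ({p // J p < 0} ≃ ι 0) := Equiv.equivOfIsEmpty _ _ |> uniqueOfSubsingleton
    simp only [weightSum, levelFactor_zero, mul_one, Fintype.sum_unique]

theorem weightSum_eq_sum_pi :
    weightSum h t J N z = ∑ e : ∀ j : {j // j ∈ Ico 1 N}, {p // J p < j} ≃ ι j,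
      ∏ j ∈ Ico 1 N,
        levelFactor h j J (familyLabelling t z e j) (familyLabelling t z e (j + 1)) := by
  have hbase {N : ℕ} (z : α → F) (hN : N ≤ 1) : weightSum h t J N z =
      ∑ e : ∀ j : {j // j ∈ Ico 1 N}, {p // J p < j} ≃ ι j, ∏ j ∈ Ico 1 N,
        levelFactor h j J (familyLabelling t z e j) (familyLabelling t z e (j + 1)) := by
    have hempty : Ico 1 N = ∅ := Ico_eq_empty_of_le hN
    have : IsEmpty {j // j ∈ Ico 1 N} := ⟨fun j => notMem_empty _ (hempty.subset j.2)⟩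
    rw [weightSum_of_le_one hN, Fintype.sum_unique]
    exact (prod_eq_one fun j hj => (notMem_empty j (hempty.subset hj)).elim).symm
  induction N generalizing z with
  | zero => exact hbase z zero_le_one
  | succ N ih =>
    obtain rfl | hN := N.eq_zero_or_pos
    · exact hbase z le_rfl
    rw [weightSum, ← Equiv.sum_comp (piIcoSuccEquiv (fun j => {p // J p < j} ≃ ι j) hN),
      Fintype.sum_prod_type]
    refine Fintype.sum_congr _ _ fun e => ?_
    rw [ih, mul_sum]
    refine Fintype.sum_congr _ _ fun e' => ?_
    have hlabel {j : ℕ} (hj : j ∈ Icc 1 N) :=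
      familyLabelling_piIcoSuccEquiv (t := t) (z := z) hN (e, e') hj
    rw [prod_Ico_succ_top hN, mul_comm, hlabel (mem_Icc.2 ⟨hN, le_rfl⟩)]
    congr 1
    · refine prod_congr rfl fun j hj => ?_
      rw [mem_Ico] at hj
      rw [hlabel (mem_Icc.2 ⟨hj.1, hj.2.le⟩), hlabel (mem_Icc.2 ⟨by lia, hj.2⟩)]
    · simp [familyLabelling]

end SumPi

section Row

variable {α F : Type*} [LinearOrder α] [Fintype α] [Field F] {h : F} {j : ℕ} {J : α → ℕ}
  {u y : α → F} {p : α}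

theorem prod_crossFactor_mul_selfFactor (hp : J p < j) :
    ∏ q, crossFactor h j J u y p q * selfFactor h j J u p q = -h *
      ((∏ q, if J q < j + 1 then if q < p then u p - y q - h else 1 else 1) *
        (∏ q, if J q < j + 1 then if p < q then u p - y q else 1 else 1) *
        ∏ q, if J q < j then if p < q then (u p - u q - h) / (u p - u q) else 1 else 1) := by
  have hdiag : -h = ∏ q, if q = p then -h else 1 := by simp only [prod_ite_eq', mem_univ, if_true]
  conv_rhs => rw [hdiag, ← prod_mul_distrib, ← prod_mul_distrib, ← prod_mul_distrib]
  refine Fintype.prod_congr _ _ fun q => ?_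
  have hp' := hp.trans j.lt_succ_self
  obtain hpq | rfl | hpq := lt_trichotomy p q
  · simp [crossFactor, selfFactor, hp, hpq, hpq.not_gt, hpq.ne']
  · simp [crossFactor, selfFactor, hp, hp']
  · simp [crossFactor, selfFactor, hp, hpq, hpq.not_gt, hpq.ne]

end Row

section Partitions

variable {N n : ℕ} {lam : Fin N → ℕ} {F : Type*} [Field F] {h : F}

/-- The map `I`, with the index of a block regarded as a natural number. -/
def blockIndex (I : Partitions n lam) (p : Fin n) : ℕ := I.1 p

/-- The numbering of the positions in `I_1 ∪ ⋯ ∪ I_j` by `enum`. -/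
def enumEquiv (I : Partitions n lam) (j : ℕ) :
    Fin (partialSum lam j) ≃ {p // blockIndex I p < j} :=
  ((blockUnion I j).orderIsoOfFin (card_blockUnion I j)).toEquiv.trans
    (Equiv.subtypeEquivRight fun p => by simp only [blockUnion, blockIndex, mem_filter_univ])

theorem blockIndex_enum_lt (I : Partitions n lam) (j : ℕ) (a : Fin (partialSum lam j)) :
    blockIndex I (enum I j a) < j :=
  (enumEquiv I j a).2

theorem prod_enum {M : Type*} [CommMonoid M] (I : Partitions n lam) (j : ℕ) (f : Fin n → M) :
    ∏ a, f (enum I j a) = ∏ p, if blockIndex I p < j then f p else 1 := by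
  have hmap : ({p | blockIndex I p < j} : Finset (Fin n)) = univ.map (enum I j).toEmbedding :=
    ((blockUnion I j).map_orderEmbOfFin_univ (card_blockUnion I j)).symm
  rw [← prod_filter, hmap, prod_map]
  rfl

theorem levelFactor_blockIndex (I : Partitions n lam) (j : ℕ) (u y : Fin n → F) :
    levelFactor h j (blockIndex I) u y =
      (-h) ^ partialSum lam j * ∏ a : Fin (partialSum lam j),
        ((∏ c with enum I (j + 1) c < enum I j a,
            (u (enum I j a) - y (enum I (j + 1) c) - h)) *
          (∏ d with enum I j a < enum I (j + 1) d, (u (enum I j a) - y (enum I (j + 1) d))) *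
          ∏ b with a < b,
            (u (enum I j a) - u (enum I j b) - h) / (u (enum I j a) - u (enum I j b))) := by
  have hrow (p : Fin n) : ∏ q, crossFactor h j (blockIndex I) u y p q *
      selfFactor h j (blockIndex I) u p q = if blockIndex I p < j then -h *
        ((∏ c with enum I (j + 1) c < p, (u p - y (enum I (j + 1) c) - h)) *
          (∏ d with p < enum I (j + 1) d, (u p - y (enum I (j + 1) d))) *
          ∏ b with p < enum I j b, (u p - u (enum I j b) - h) / (u p - u (enum I j b))) else 1 := by
    split_ifs with hp
    · rw [prod_crossFactor_mul_selfFactor hp]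
      simp only [prod_filter, ← prod_enum]
    · simp only [crossFactor, selfFactor, hp, false_and, if_false, mul_one, prod_const_one]
  rw [levelFactor, Fintype.prod_prod_type]
  simp only [hrow, ← prod_enum, prod_mul_distrib, prod_const, card_univ, Fintype.card_fin,
    OrderEmbedding.lt_iff_lt]

theorem prod_levelFactor_eq_neg_pow_mul_U (I : Partitions n lam) (y : ℕ → Fin n → F) :
    ∏ j ∈ Ico 1 N, levelFactor h j (blockIndex I) (y j) (y (j + 1)) =
      (-h) ^ (∑ j ∈ Ico 1 N, partialSum lam j) * U I (fun j a => y j (enum I j a)) h := by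
  rw [← prod_pow_eq_pow_sum, U, ← prod_mul_distrib]
  exact prod_congr rfl fun j _ => levelFactor_blockIndex I j _ _

theorem enum_eq_castLE (I : Partitions n lam) {j : ℕ} (hj : N ≤ j) (a : Fin (partialSum lam j)) :
    enum I j a = Fin.castLE (partialSum_le I j) a := by
  have hmem (p : Fin n) : p ∈ blockUnion I j := by
    simpa only [blockUnion, mem_filter_univ] using (I.1 p).2.trans_le hj
  exact (congrFun (orderEmbOfFin_unique (card_blockUnion I j) (fun _ => hmem _)
    (Fin.strictMono_castLE _)) a).symm

theorem levels_eq_familyLabelling (I : Partitions n lam) (t : ∀ j, Fin (partialSum lam j) → F)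
    (z : Fin n → F) (τ : ∀ j : {j // j ∈ Ico 1 N}, Equiv.Perm (Fin (partialSum lam j))) :
    levels I (fun j a => t j (τ j a)) z = fun j a =>
      familyLabelling t z (fun j => (enumEquiv I j).symm.trans (τ j)) j (enum I j a) := by
  ext j a
  by_cases hj : j ∈ Ico 1 N
  · have henum : (enumEquiv I j).symm ⟨enum I j a, blockIndex_enum_lt I j a⟩ = a :=
      (enumEquiv I j).symm_apply_apply a
    rw [levels, dif_pos hj, familyLabelling, dif_pos hj, labelling_of_lt (blockIndex_enum_lt I j a),
      Equiv.trans_apply, henum]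
  · rw [levels, dif_neg hj, familyLabelling, dif_neg hj, enum_eq_castLE]
    obtain rfl | hpos := j.eq_zero_or_pos
    · exact (Nat.not_lt_zero _ (blockIndex_enum_lt I 0 a)).elim
    · exact not_lt.1 fun hlt => hj (mem_Ico.2 ⟨hpos, hlt⟩)

theorem W_eq_weightSum (I : Partitions n lam) (t : ∀ j, Fin (partialSum lam j) → F)
    (z : Fin n → F) : W I (fun j a => t j a) z h = weightSum h t (blockIndex I) N z := by
  have : IsEmpty (Fin (partialSum lam 0)) :=
    ⟨fun a => Nat.not_lt_zero _ (blockIndex_enum_lt I 0 a)⟩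
  rw [W, mul_sum, weightSum_eq_sum_pi]
  refine Fintype.sum_equiv (Equiv.piCongrRight fun j : {j // j ∈ Ico 1 N} =>
    Equiv.equivCongr (enumEquiv I j) (Equiv.refl (Fin (partialSum lam j)))) _ _ fun τ => ?_
  rw [prod_levelFactor_eq_neg_pow_mul_U, levels_eq_familyLabelling]
  rfl

theorem W_enum_eq_weightAt (J I : Partitions n lam) (z : Fin n → F) :
    W J (fun j a => z (enum I j a)) z h = weightAt h z (blockIndex J) (blockIndex I) N :=
  (W_eq_weightSum J (fun j a => z (enum I j a)) z).trans <|
    weightSum_comp_equiv (t := fun j (p : {p // blockIndex I p < j}) => z p) (enumEquiv I)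

theorem W_rev_enum_eq_weightAt (K I : Partitions n lam) (z : Fin n → F) :
    W (permInv Fin.revPerm K) (fun j a => z (enum I j a)) (fun a => z (Fin.revPerm a)) h =
      weightAt h (z ∘ ofDual) (blockIndex K ∘ ofDual) (blockIndex I ∘ ofDual) N := by
  have hrev : (Fin.revPerm : Fin n → Fin n) ∘ Fin.revOrderIso = ofDual :=
    funext fun p => Fin.rev_rev (ofDual p)
  calc
    _ = weightSum h (fun j a => z (enum I j a)) (blockIndex K ∘ Fin.revPerm) N
        (z ∘ Fin.revPerm) := W_eq_weightSum _ (fun j a => z (enum I j a)) _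
    _ = weightSum h (fun j a => z (enum I j a)) (blockIndex K ∘ ofDual) N (z ∘ ofDual) := by
      rw [← weightSum_comp_orderIso Fin.revOrderIso, Function.comp_assoc, Function.comp_assoc, hrev]
    _ = _ := weightSum_comp_equiv
      (t := fun j (p : {p : (Fin n)ᵒᵈ // (blockIndex I ∘ ofDual) p < j}) => (z ∘ ofDual) p)
      (enumEquiv I)

end Partitions

section Pairing

variable {α F : Type*} [LinearOrder α] [Fintype α] [Field F] {h : F} {z : α → F} {J K I : α → ℕ}
  {N : ℕ} {a b : α}

theorem weightAt_exchange (hab : a ⋖ b) (hz : Function.Injective z) (ha : J a < N) (hb : J b < N) :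
    (z a - z b + h) * weightAt h (z ∘ swap a b) J (I ∘ swap a b) N =
      h * weightAt h z J I N + (z a - z b) * weightAt h z (J ∘ swap a b) I N := by
  have hrelabel : weightAt h (z ∘ swap a b) J (I ∘ swap a b) N =
      weightSum h (fun j (p : {p // I p < j}) => z p) J N (z ∘ swap a b) :=
    weightSum_comp_equiv (t := fun j (p : {p // I p < j}) => z p)
      fun j => (swap a b).subtypeEquiv fun _ => .rfl
  rw [hrelabel]
  exact weightSum_exchange hab (fun j => hz.comp Subtype.val_injective) ha hb

/-- The summand with index `I` of the pairing of `W_{id,J}` and `W_{σ₀,K}`, where `W_{σ₀,K}` is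
expressed as the weight function of `K` for the reversed order of positions. -/
def pairingTerm (h : F) (z : α → F) (J K I : α → ℕ) (N : ℕ) : F :=
  weightAt h z J I N * weightAt h (z ∘ ofDual) (K ∘ ofDual) (I ∘ ofDual) N / pairingDenom h z I N

theorem pairingTerm_exchange (hab : a ⋖ b) (hz : Function.Injective z) (hJ : ∀ p, J p < N)
    (hK : ∀ p, K p < N) :
    (z a - z b) * pairingTerm h z (J ∘ swap a b) K I N =
      h * pairingTerm h (z ∘ swap a b) J K (I ∘ swap a b) N +
        (z a - z b) * pairingTerm h (z ∘ swap a b) J (K ∘ swap a b) (I ∘ swap a b) N -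
        h * pairingTerm h z J K I N := by
  have hexch := weightAt_exchange (h := h) (I := I) hab hz (hJ a) (hJ b)
  have hdual : (z a - z b + h) * weightAt h (z ∘ ofDual) (K ∘ ofDual) (I ∘ ofDual) N =
      h * weightAt h (z ∘ swap a b ∘ ofDual) (K ∘ ofDual) (I ∘ swap a b ∘ ofDual) N +
        (z a - z b) *
          weightAt h (z ∘ swap a b ∘ ofDual) (K ∘ swap a b ∘ ofDual) (I ∘ swap a b ∘ ofDual) N := by
    have hswap : ⇑(swap (toDual b) (toDual a)) = toDual ∘ swap a b ∘ ofDual := by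
      rw [Equiv.swap_comm]
      rfl
    have hz' : Function.Injective (z ∘ swap a b ∘ ofDual) :=
      hz.comp ((swap a b).injective.comp ofDual.injective)
    have := weightAt_exchange (h := h) (I := I ∘ swap a b ∘ ofDual)
      (toDual_covBy_toDual_iff.2 hab) hz' (J := K ∘ ofDual) (hK b) (hK a)
    rw [hswap] at this
    simpa [Function.comp_def] using this
  unfold pairingTerm
  rw [pairingDenom_comp_equiv]
  simp only [div_eq_mul_inv, Function.comp_assoc]
  linear_combination (pairingDenom h z I N)⁻¹ *
    (weightAt h (z ∘ swap a b) J (I ∘ swap a b) N * hdual -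
      weightAt h (z ∘ ofDual) (K ∘ ofDual) (I ∘ ofDual) N * hexch)

theorem pairingTerm_self (hz : Function.Injective z) (hh : ∀ p q, z p - z q ≠ h)
    (hJ : ∀ p, J p < N) : pairingTerm h z J J J N = 1 :=
  (div_eq_one_iff_eq (pairingDenom_ne_zero hz hh)).2 (weightAt_self_mul_toDual hz hJ)

theorem eq_and_eq_of_pairingTerm_ne_zero (hJ : ∀ p, J p < N) (hK : ∀ p, K p < N)
    (hI : ∀ p, I p < N) (hmono : Monotone J) (hne : pairingTerm h z J K I N ≠ 0) :
    I = J ∧ K = J := by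
  have hnum := (div_ne_zero_iff.1 hne).1
  obtain rfl := eq_of_monotone_of_weightAt_ne_zero hJ hI hmono (left_ne_zero_of_mul hnum)
  have := eq_of_antitone_of_weightAt_ne_zero (fun p => hK (ofDual p)) (fun p => hJ (ofDual p))
    hmono.dual_left (right_ne_zero_of_mul hnum)
  exact ⟨rfl, ofDual.surjective.injective_comp_right this⟩

end Pairing

section Orthogonality

variable {N n : ℕ} {lam : Fin N → ℕ} {F : Type*} [Field F] {h : F} {z : Fin n → F}

theorem blockIndex_lt (I : Partitions n lam) (p : Fin n) : blockIndex I p < N :=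
  (I.1 p).2

theorem blockIndex_injective : Function.Injective (blockIndex : Partitions n lam → Fin n → ℕ) :=
  fun _ _ hIJ => Subtype.ext (funext fun p => Fin.ext (congrFun hIJ p))

theorem permInv_permInv (σ τ : Equiv.Perm (Fin n)) (I : Partitions n lam) :
    permInv σ (permInv τ I) = permInv (τ * σ) I :=
  rfl

theorem permInv_swap_permInv_swap (a b : Fin n) (I : Partitions n lam) :
    permInv (swap a b) (permInv (swap a b) I) = I := by
  rw [permInv_permInv, Equiv.swap_mul_self]
  rfl

/-- The sum over `I` pairing `W_{id,J}` with `W_{σ₀,K}`. -/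
def pairing (h : F) (z : Fin n → F) (J K : Partitions n lam) : F :=
  ∑ I : Partitions n lam, pairingTerm h z (blockIndex J) (blockIndex K) (blockIndex I) N

theorem pairing_of_monotone (hz : Function.Injective z) (hh : ∀ p q, z p - z q ≠ h)
    {J : Partitions n lam} (hJ : Monotone J.1) (K : Partitions n lam) :
    pairing h z J K = if J = K then 1 else 0 := by
  have hne {I : Partitions n lam}
      (hI : pairingTerm h z (blockIndex J) (blockIndex K) (blockIndex I) N ≠ 0) :
      I = J ∧ K = J :=
    (eq_and_eq_of_pairingTerm_ne_zero (blockIndex_lt J) (blockIndex_lt K) (blockIndex_lt I)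
      (fun _ _ hpq => hJ hpq) hI).imp (blockIndex_injective ·) (blockIndex_injective ·)
  rw [pairing, Fintype.sum_eq_single J fun I hI => by_contra fun h0 => hI (hne h0).1]
  split_ifs with hJK
  · rw [← hJK, pairingTerm_self hz hh (blockIndex_lt J)]
  · exact by_contra fun h0 => hJK (hne h0).2.symm

theorem pairing_permInv_swap {a b : Fin n} (hab : a ⋖ b) (hz : Function.Injective z)
    (J K : Partitions n lam) :
    (z a - z b) * pairing h z (permInv (swap a b) J) K =
      h * pairing h (z ∘ swap a b) J K +
        (z a - z b) * pairing h (z ∘ swap a b) J (permInv (swap a b) K) -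
        h * pairing h z J K := by
  have hsum (J K : Partitions n lam) : pairing h (z ∘ swap a b) J K =
      ∑ I : Partitions n lam, pairingTerm h (z ∘ swap a b) (blockIndex J) (blockIndex K)
        (blockIndex I ∘ swap a b) N :=
    ((Function.Involutive.bijective (permInv_swap_permInv_swap a b)).sum_comp _).symm
  rw [hsum, hsum]
  simp only [pairing, mul_sum, ← sum_add_distrib, ← sum_sub_distrib]
  exact Fintype.sum_congr _ _ fun I =>
    pairingTerm_exchange hab hz (blockIndex_lt J) (blockIndex_lt K)

theorem induction_on_permInv_swap {P : Partitions n lam → Prop}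
    (hmono : ∀ J : Partitions n lam, Monotone J.1 → P J)
    (hswap : ∀ (J : Partitions n lam) (a b : Fin n), a ⋖ b → P J → P (permInv (swap a b) J))
    (J : Partitions n lam) : P J := by
  cases n with
  | zero => exact hmono J fun p => p.elim0
  | succ n =>
    have hperm (τ : Equiv.Perm (Fin (n + 1))) : ∀ J : Partitions (n + 1) lam,
        P J → P (permInv τ J) := by
      have hτ : τ ∈ Submonoid.closure (Set.range fun i : Fin n => swap i.castSucc i.succ) :=
        Equiv.Perm.mclosure_swap_castSucc_succ n ▸ Submonoid.mem_top τ
      induction hτ using Submonoid.closure_induction with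
      | mem τ hτ =>
        obtain ⟨i, rfl⟩ := hτ
        exact fun J => hswap J _ _ (Fin.covBy_iff.2 (Nat.covBy_iff_add_one_eq.2 rfl))
      | one => exact fun J hJ => hJ
      | mul τ _ _ _ hτ hτ' => exact fun J hJ => hτ' _ (hτ J hJ)
    have := hperm (Tuple.sort J.1)⁻¹ _ (hmono (permInv _ J) (Tuple.monotone_sort J.1))
    rwa [permInv_permInv, mul_inv_cancel] at this

theorem pairing_eq (hz : Function.Injective z) (hh : ∀ p q, z p - z q ≠ h)
    (J K : Partitions n lam) : pairing h z J K = if J = K then 1 else 0 := by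
  induction J using induction_on_permInv_swap generalizing z K with
  | hmono J hJ => exact pairing_of_monotone hz hh hJ K
  | hswap J a b hab ih =>
    have hexch := pairing_permInv_swap (h := h) hab hz J K
    have hiff : J = permInv (swap a b) K ↔ permInv (swap a b) J = K :=
      ⟨fun hJ => hJ ▸ permInv_swap_permInv_swap a b K,
        fun hK => hK ▸ (permInv_swap_permInv_swap a b J).symm⟩
    have hz' := hz.comp (swap a b).injective
    rw [ih hz' fun p q => hh _ _, ih hz' fun p q => hh _ _, ih hz hh, add_sub_right_comm, sub_self,
      zero_add, if_congr hiff rfl rfl] at hexch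
    exact mul_left_cancel₀ (sub_ne_zero.2 (hz.ne hab.ne)) hexch

end Orthogonality

section Denominators

variable {N n : ℕ} {lam : Fin N → ℕ}

theorem prod_block {M : Type*} [CommMonoid M] (I : Partitions n lam) (f : Fin N → Fin n → M) :
    ∏ a, ∏ i ∈ block I a, f a i = ∏ i, f (I.1 i) i := by
  rw [← prod_fiberwise univ I.1 fun i => f (I.1 i) i]
  exact Fintype.prod_congr _ _ fun a => prod_congr rfl fun i hi => by rw [(mem_filter.1 hi).2]

theorem prod_block_prod_block {M : Type*} [CommMonoid M] (I : Partitions n lam)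
    (f : Fin n → Fin n → M) :
    ∏ a : Fin N, ∏ b with a < b, ∏ i ∈ block I a, ∏ j ∈ block I b, f i j =
      ∏ x : Fin n × Fin n with blockIndex I x.1 < blockIndex I x.2, f x.1 x.2 := by
  have hinner (a : Fin N) (i : Fin n) :
      ∏ b with a < b, ∏ j ∈ block I b, f i j = ∏ j, if a < I.1 j then f i j else 1 := by
    rw [prod_filter, ← prod_block I fun b j => if a < b then f i j else 1]
    simp only [prod_ite_irrel, prod_const_one]
  simp only [prod_comm (s := univ.filter _), hinner]
  rw [prod_block I fun a i => ∏ j, if a < I.1 j then f i j else 1, prod_filter,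
    Fintype.prod_prod_type]
  rfl

theorem c_eq_prod_range (I : Partitions n lam) :
    c I = ∏ j ∈ range N, ∏ x : Fin n × Fin n with blockIndex I x.1 < j ∧ blockIndex I x.2 < j,
      (zvar x.1 - zvar x.2 - hvar) := by
  have hzero (j : ℕ) (hj : j ∈ range N) (hj' : j ∉ Ico 1 N) :
      ∏ x : Fin n × Fin n with blockIndex I x.1 < j ∧ blockIndex I x.2 < j,
        (zvar x.1 - zvar x.2 - hvar) = 1 := by
    refine prod_eq_one fun x hx => ?_
    simp only [mem_range, mem_Ico, mem_filter_univ] at hj hj' hx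
    lia
  have hprod (j : ℕ) : univ.filter (fun x : Fin n × Fin n =>
      blockIndex I x.1 < j ∧ blockIndex I x.2 < j) = blockUnion I j ×ˢ blockUnion I j := by
    ext x
    simp only [blockUnion, mem_filter_univ, mem_product]
    rfl
  rw [c, ← prod_subset (range_eq_Ico N ▸ Ico_subset_Ico_left zero_le_one) hzero]
  simp only [hprod, prod_product]

theorem R_mul_Q_mul_c_sq (I : Partitions n lam) :
    R I * Q I * c I ^ 2 = pairingDenom hvar zvar (blockIndex I) N := by
  rw [R, Q, prod_block_prod_block, prod_block_prod_block, ← prod_mul_distrib, c_eq_prod_range,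
    pairingDenom]

theorem zvar_sub_zvar_ne_hvar (p q : Fin n) : zvar p - zvar q ≠ hvar := by
  intro heq
  rw [zvar, zvar, hvar, ← map_sub] at heq
  have := congrArg (MvPolynomial.eval fun v => match v with | .z _ => 0 | .h => 1)
    (IsFractionRing.injective (MvPolynomial (ZHVar n) ℂ) (RatZH n) heq)
  simp at this

end Denominators

end WeightFn

end

theorem lemma3p6_general {N n : ℕ} {F : Type*} [Field F] (lam : Fin N → ℕ) (z : Fin n → F)
    (hz : Function.Injective z) (h : F) (hh : ∀ p q, z p - z q ≠ h)
    (J K : WeightFn.Partitions n lam) :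
    ∑ I : WeightFn.Partitions n lam,
        WeightFn.W J (fun j a => z (WeightFn.enum I j a)) z h *
            WeightFn.W (WeightFn.permInv Fin.revPerm K) (fun j a => z (WeightFn.enum I j a))
              (fun a => z (Fin.revPerm a)) h /
          WeightFn.pairingDenom h z (WeightFn.blockIndex I) N =
      if J = K then 1 else 0 := by
  simp only [WeightFn.W_enum_eq_weightAt, WeightFn.W_rev_enum_eq_weightAt]
  exact WeightFn.pairing_eq hz hh J K

theorem lemma3p6 {N n : ℕ} (lam : Fin N → ℕ) (hlam : ∑ k, lam k = n)
    (J K : WeightFn.Partitions n lam) :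
    ∑ I : WeightFn.Partitions n lam,
        WeightFn.subst I (WeightFn.weightFunction 1 J) *
            WeightFn.subst I (WeightFn.weightFunction Fin.revPerm K) /
          (WeightFn.R I * WeightFn.Q I * WeightFn.c I ^ 2) =
      if J = K then 1 else 0 := by
  simp only [WeightFn.subst_weightFunction, WeightFn.R_mul_Q_mul_c_sq]
  exact lemma3p6_general lam WeightFn.zvar WeightFn.zvar_injective WeightFn.hvar
    WeightFn.zvar_sub_zvar_ne_hvar J K
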